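/- Let $m,n$ be positive integers, $d=\gcd(m,n)$, $m=ad$, $n=bd$, and let $G=\langle x,y\mid x^m=y^n\rangle$. Let $X$ be the $SL(2,\mathbb{C})$-character variety of $G$, i.e. the set of characters $\chi_\rho\colon g\mapsto\operatorname{tr}\rho(g)$ of homomorphisms $\rho\colon G\to SL(2,\mathbb{C})$, with its classical topology (as a subspace of $\mathbb{C}^G$ with pointwise convergence), and let $Y_{red}\subset X$ be the set of characters of reducible $SU(2)$-representations of $G$. Put $\xi=e^{2\pi i/d}$ and, for $j\in\mathbb{Z}/d\mathbb{Z}$, let $Y_{red}^{j}\subset Y_{red}$ be the set of characters of the $SU(2)$-representations $x\mapsto\operatorname{diag}(\lambda,\lambda^{-1})$, $y\mapsto\operatorname{diag}(\mu,\mu^{-1})$ with $\lambda^a=\xi^{j}\mu^b$ (so that $Y_{red}^{j}=Y_{red}^{-j}$). Let $0<k<m$, $0<k'<n$ with $k\equiv k'\pmod 2$, put $\lambda=e^{\pi i k/m}$ and $\mu=e^{\pi i k'/n}$, and let $Y_{irr}^{(k,k')}\subset X$ be the set of characters of the irreducible representations $\rho\colon G\to SU(2)$ such that $\lambda$ is an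 eigenvalue of $\rho(x)$ and $\mu$ is an eigenvalue of $\rho(y)$. Then the closure of $Y_{irr}^{(k,k')}$ in $X$ is a closed interval that joins $Y_{red}^{i_0}$ to $Y_{red}^{i_1}$, where $i_0\equiv\frac{k-k'}{2}$ and $i_1\equiv\frac{k+k'}{2}\pmod d$. More precisely, there is a homeomorphism $\gamma$ from $[0,1]$ onto $\overline{Y_{irr}^{(k,k')}}$ with $\gamma(t)\in Y_{irr}^{(k,k')}$ if and only if $0<t<1$, such that $\gamma(0)\in Y_{red}^{i_0}$ is the character of the $SU(2)$-representation $x\mapsto\operatorname{diag}(\lambda,\lambda^{-1})$, $y\mapsto\operatorname{diag}(\mu,\mu^{-1})$, and $\gamma(1)\in Y_{red}^{i_1}$ is the character of $x\mapsto\operatorname{diag}(\lambda,\lambda^{-1})$, $y\mapsto\operatorname{diag}(\mu^{-1},\mu)$; moreover $\overline{Y_{irr}^{(k,k')}}\cap Y_{red}=\{\gamma(0),\gamma(1)\}$. -/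

import Mathlib

/-- The group `⟨x, y ∣ x ^ m = y ^ n⟩`; the generator `0` is `x`, the generator `1` is `y`. -/
abbrev TorusGroup (m n : ℕ) : Type :=
  PresentedGroup
    ({(FreeGroup.of 0) ^ m * ((FreeGroup.of 1) ^ n)⁻¹} : Set (FreeGroup (Fin 2)))

namespace TorusGroup

/-- The generator `x`. -/
def x (m n : ℕ) : TorusGroup m n := PresentedGroup.of 0

/-- The generator `y`. -/
def y (m n : ℕ) : TorusGroup m n := PresentedGroup.of 1

end TorusGroup

/-- The group `SL(2, ℂ)`. -/
abbrev SL2C : Type := Matrix.SpecialLinearGroup (Fin 2) ℂ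

/-- The group `SU(2)`. -/
abbrev SU2 : Type := Matrix.specialUnitaryGroup (Fin 2) ℂ

/-- The inclusion of `SU(2)` in `SL(2, ℂ)`. -/
def inclSU2 : SU2 →* SL2C where
  toFun A := ⟨A.1, (Matrix.mem_specialUnitaryGroup_iff.1 A.2).2⟩
  map_one' := rfl
  map_mul' _ _ := rfl

section Characters

variable {G : Type*} [Group G]

/-- The linear representation on `ℂ²` given by a homomorphism to `SL(2, ℂ)`. -/
def linRep (ρ : G →* SL2C) : Representation ℂ G (Fin 2 → ℂ) where
  toFun g := Matrix.toLin' (ρ g).1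
  map_one' := by simp [Module.End.one_eq_id]
  map_mul' g h := by simp [Matrix.toLin'_mul, Module.End.mul_eq_comp]

variable (G) in
/-- The `SL(2, ℂ)`-character variety of `G`: the set of the functions `g ↦ tr (ρ g)`. As a
subtype of `G → ℂ` it carries the topology of pointwise convergence; for finitely generated `G`
this is the classical topology of the algebraic variety, since every trace is a polynomial in
finitely many of them. -/
abbrev CharVariety : Type _ :=
  {χ : G → ℂ // ∃ ρ : G →* SL2C, χ = fun g => Matrix.trace (ρ g).1}

/-- The character of an `SL(2, ℂ)`-representation, as a point of the character variety. -/
def charPoint (ρ : G →* SL2C) : CharVariety G :=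
  ⟨fun g => Matrix.trace (ρ g).1, ρ, rfl⟩

/-- The point of the `SL(2, ℂ)`-character variety defined by an `SU(2)`-representation. -/
def charPointSU2 (ρ : G →* SU2) : CharVariety G := charPoint (inclSU2.comp ρ)

/-- Irreducibility of an `SU(2)`-representation, on `ℂ²`. -/
def IrredSU2 (ρ : G →* SU2) : Prop := (linRep (inclSU2.comp ρ)).IsIrreducible

variable (G) in
/-- The characters of the reducible `SU(2)`-representations. -/
def YRed : Set (CharVariety G) :=
  {χ | ∃ ρ : G →* SU2, ¬ IrredSU2 ρ ∧ χ = charPointSU2 ρ}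

end Characters

/-- `χ` is the character of the `SU(2)`-representation
`x ↦ diag (l, l⁻¹)`, `y ↦ diag (u, u⁻¹)`. -/
def IsDiagChar {m n : ℕ} (χ : CharVariety (TorusGroup m n)) (l u : ℂ) : Prop :=
  ∃ ρ : TorusGroup m n →* SU2,
    (ρ (TorusGroup.x m n)).1 = Matrix.diagonal ![l, l⁻¹] ∧
    (ρ (TorusGroup.y m n)).1 = Matrix.diagonal ![u, u⁻¹] ∧
    χ = charPointSU2 ρ

/-- The component of the reducible `SU(2)`-characters with index `i`: with `d = gcd (m, n)`,
`m = a d`, `n = b d` and `ξ = exp (2 π i / d)`, the eigenvalues satisfy `l ^ a = ξ ^ i * u ^ b`. -/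
def YRedComp (m n : ℕ) (i : ℤ) : Set (CharVariety (TorusGroup m n)) :=
  {χ | ∃ l u : ℂ,
    l ^ (m / m.gcd n) =
      Complex.exp (2 * Real.pi * Complex.I / (m.gcd n : ℂ)) ^ i * u ^ (n / m.gcd n) ∧
    IsDiagChar χ l u}

/-- The number `exp (π i k / m)`. -/
noncomputable def eigVal (m k : ℕ) : ℂ := Complex.exp (Real.pi * Complex.I * k / m)

/-- The characters of the irreducible `SU(2)`-representations for which `exp (π i k / m)` is an
eigenvalue of the image of `x` and `exp (π i k' / n)` an eigenvalue of the image of `y`. -/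
def YIrrComp (m n k k' : ℕ) : Set (CharVariety (TorusGroup m n)) :=
  {χ | ∃ ρ : TorusGroup m n →* SU2, IrredSU2 ρ ∧
    Module.End.HasEigenvalue (Matrix.toLin' (ρ (TorusGroup.x m n)).1) (eigVal m k) ∧
    Module.End.HasEigenvalue (Matrix.toLin' (ρ (TorusGroup.y m n)).1) (eigVal n k') ∧
    χ = charPointSU2 ρ}

/-! A character of `G` is determined by, and depends continuously on, the traces of `x`, `y` and `x
y` (`exists_normalForm`, `exists_traceFun`). Put `α = π k / m`, `β = π k' / n`. The eigenvalue
conditions fix the first two traces as `2 cos α`, `2 cos β`. In unit quaternions the third is `2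
(cos α cos β - sin α sin β cos φ)`, with `φ ∈ [0, π]` the angle between the rotation axes of `x` and
`y` (`SU2.exists_angle`). Every `φ` occurs: `x ^ m` and `y ^ n` map to the central elements `(-1) ^
k` and `(-1) ^ k'`, which agree by parity, so the axis of `y` can be turned freely (`arcRep`). The
commutator of the generators has determinant `(2 sin α sin β sin φ) ^ 2`, which vanishes exactly for
reducible representations (`irredSU2_iff_sin_ne_zero`). Hence the irreducible characters form the
injective image of `(0, π)`, and compactness of `[0, π]` gives the closure. At the ends the axes are
parallel or antiparallel, so both generators are diagonal. -/

/-! ### Trace identities for `2 × 2` matrices -/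

section TwoByTwo

open Matrix

/-- The Cayley–Hamilton identity for a `2 × 2` matrix of determinant one. -/
lemma mul_self_of_det_eq_one {A : Matrix (Fin 2) (Fin 2) ℂ} (hA : A.det = 1) :
    A * A = A.trace • A - 1 := by
  rw [det_fin_two] at hA
  ext i j
  fin_cases i <;> fin_cases j <;>
    simp [Matrix.mul_apply, Fin.sum_univ_two, trace_fin_two] <;>
    first | ring1 | linear_combination -hA

/-- The polarized Cayley–Hamilton identity for `2 × 2` matrices. -/
lemma mul_comm_fin_two (A B : Matrix (Fin 2) (Fin 2) ℂ) :
    B * A = (((A * B).trace - A.trace * B.trace) • (1 : Matrix (Fin 2) (Fin 2) ℂ)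
      + B.trace • A + A.trace • B) - A * B := by
  ext i j
  fin_cases i <;> fin_cases j <;>
    simp [Matrix.mul_apply, Fin.sum_univ_two, trace_fin_two] <;> ring

/-- Specializes an identity for arbitrary `A`, `B` in which the terms `4`, `(tr A) ^ 2`, `(tr B) ^
2` carry the factors `det A det B`, `det B`, `det A`. -/
lemma det_commutator {A B : Matrix (Fin 2) (Fin 2) ℂ} (hA : A.det = 1) (hB : B.det = 1) :
    (A * B - B * A).det = 4 - A.trace ^ 2 - B.trace ^ 2 - (A * B).trace ^ 2
      + A.trace * B.trace * (A * B).trace := by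
  rw [det_fin_two] at *
  simp only [trace_fin_two, Matrix.sub_apply, Matrix.mul_apply, Fin.sum_univ_two]
  linear_combination
    (4 * (B 0 0 * B 1 1 - B 0 1 * B 1 0) - (B 0 0 + B 1 1) ^ 2) * hA
      + (4 - (A 0 0 + A 1 1) ^ 2) * hB

lemma hasEigenvalue_toLin'_fin_two (A : Matrix (Fin 2) (Fin 2) ℂ) (l : ℂ) :
    Module.End.HasEigenvalue (toLin' A) l ↔ l ^ 2 - A.trace * l + A.det = 0 := by
  rw [Module.End.hasEigenvalue_iff_isRoot_charpoly, Matrix.charpoly_toLin', charpoly_fin_two]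
  simp [Polynomial.IsRoot]

end TwoByTwo

/-! ### Trace coordinates on the character variety -/

section NormalForm

open Matrix TorusGroup

variable {m n : ℕ}

lemma TorusGroup.closure_generators (m n : ℕ) :
    Subgroup.closure ({x m n, y m n} : Set (TorusGroup m n)) = ⊤ := by
  rw [← PresentedGroup.closure_range_of]
  congr 1
  ext g
  simp [Fin.exists_fin_two, x, y, eq_comm]

lemma TorusGroup.induction_left {p : TorusGroup m n → Prop} (one : p 1)
    (hx : ∀ g, p g → p (x m n * g)) (hy : ∀ g, p g → p (y m n * g))
    (hx' : ∀ g, p g → p ((x m n)⁻¹ * g)) (hy' : ∀ g, p g → p ((y m n)⁻¹ * g))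
    (g : TorusGroup m n) : p g := by
  have hg : g ∈ Subgroup.closure ({x m n, y m n} : Set (TorusGroup m n)) := by
    rw [closure_generators]; trivial
  induction hg using Subgroup.closure_induction_left with
  | one => exact one
  | mul_left z hz w _ hw =>
    rcases hz with rfl | rfl
    exacts [hx _ hw, hy _ hw]
  | inv_mul_cancel z hz w _ hw =>
    rcases hz with rfl | rfl
    exacts [hx' _ hw, hy' _ hw]

/-- The traces of the images of `x`, `y` and `x y`. -/
noncomputable def traceCoords (ρ : TorusGroup m n →* SL2C) : ℂ × ℂ × ℂ :=
  ((ρ (x m n)).1.trace, (ρ (y m n)).1.trace, ((ρ (x m n)).1 * (ρ (y m n)).1).trace)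

lemma SL2C.coe_mul_eq (A B : SL2C) : (A * B).1 = A.1 * B.1 := rfl

lemma SL2C.coe_inv_eq (A : SL2C) : (A⁻¹).1 = A.1.trace • (1 : Matrix (Fin 2) (Fin 2) ℂ) - A.1 := by
  change A.1.adjugate = _
  rw [adjugate_fin_two]
  ext i j
  fin_cases i <;> fin_cases j <;> simp [trace_fin_two]

/-- Every word in two elements of `SL(2, ℂ)` is a combination of `1, X, Y, X Y` whose coefficients
are universal continuous functions of the three traces `tr X`, `tr Y`, `tr (X Y)`. -/
lemma exists_normalForm (g : TorusGroup m n) :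
    ∃ a b c d : ℂ × ℂ × ℂ → ℂ, (Continuous a ∧ Continuous b ∧ Continuous c ∧ Continuous d) ∧
      ∀ ρ : TorusGroup m n →* SL2C,
        (ρ g).1 = a (traceCoords ρ) • (1 : Matrix (Fin 2) (Fin 2) ℂ)
          + b (traceCoords ρ) • (ρ (x m n)).1
          + c (traceCoords ρ) • (ρ (y m n)).1
          + d (traceCoords ρ) • ((ρ (x m n)).1 * (ρ (y m n)).1) := by
  induction g using TorusGroup.induction_left with
  | one =>
    exact ⟨fun _ => 1, fun _ => 0, fun _ => 0, fun _ => 0,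
      ⟨by fun_prop, by fun_prop, by fun_prop, by fun_prop⟩,
      fun ρ => by simp⟩
  | hx g ih =>
    obtain ⟨a, b, c, d, ⟨ha, hb, hc, hd⟩, h⟩ := ih
    -- Coefficients of `X (a + b X + c Y + d X Y)` after substituting `X ^ 2 = (tr X) X - 1`.
    refine ⟨fun z => - b z, fun z => a z + z.1 * b z, fun z => - d z, fun z => c z + z.1 * d z,
      ⟨by fun_prop, by fun_prop, by fun_prop, by fun_prop⟩,
      fun ρ => ?_⟩
    rw [map_mul, SL2C.coe_mul_eq, h ρ]
    simp only [traceCoords, mul_add, mul_smul_comm, mul_one, ← mul_assoc,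
      mul_self_of_det_eq_one (ρ (x m n)).2, sub_mul, smul_mul_assoc, one_mul]
    module
  | hy g ih =>
    obtain ⟨a, b, c, d, ⟨ha, hb, hc, hd⟩, h⟩ := ih
    -- Left multiplication by `Y`: the polarized identity moves `Y` past `X`, then `Y ^ 2` is
    -- reduced.
    refine ⟨fun z => b z * (z.2.2 - z.1 * z.2.1) - c z - d z * z.1,
      fun z => b z * z.2.1 + d z, fun z => a z + b z * z.1 + c z * z.2.1 + d z * z.2.2,
      fun z => - b z, ⟨by fun_prop, by fun_prop, by fun_prop, by fun_prop⟩,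
      fun ρ => ?_⟩
    rw [map_mul, SL2C.coe_mul_eq, h ρ]
    simp only [traceCoords, mul_add, mul_smul_comm, mul_one, ← mul_assoc,
      mul_comm_fin_two (ρ (x m n)).1 (ρ (y m n)).1, sub_mul, add_mul, smul_mul_assoc, one_mul]
    simp only [mul_assoc, mul_self_of_det_eq_one (ρ (y m n)).2, mul_sub, mul_smul_comm, mul_one]
    module
  | hx' g ih =>
    obtain ⟨a, b, c, d, ⟨ha, hb, hc, hd⟩, h⟩ := ih
    -- The inverse is `(tr X) - X`, so these are `tr X` times the old coefficients minus those for
    -- multiplication by `X`.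
    refine ⟨fun z => z.1 * a z + b z, fun z => - a z, fun z => z.1 * c z + d z, fun z => - c z,
      ⟨by fun_prop, by fun_prop, by fun_prop, by fun_prop⟩,
      fun ρ => ?_⟩
    rw [map_mul, map_inv, SL2C.coe_mul_eq, SL2C.coe_inv_eq, h ρ]
    simp only [traceCoords, mul_add, mul_smul_comm, mul_one, ← mul_assoc,
      mul_self_of_det_eq_one (ρ (x m n)).2, sub_mul, smul_mul_assoc, one_mul]
    module
  | hy' g ih =>
    obtain ⟨a, b, c, d, ⟨ha, hb, hc, hd⟩, h⟩ := ih
    refine ⟨fun z => z.2.1 * a z - (b z * (z.2.2 - z.1 * z.2.1) - c z - d z * z.1),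
      fun z => - d z, fun z => - (a z + b z * z.1 + d z * z.2.2),
      fun z => z.2.1 * d z + b z, ⟨by fun_prop, by fun_prop, by fun_prop, by fun_prop⟩,
      fun ρ => ?_⟩
    rw [map_mul, map_inv, SL2C.coe_mul_eq, SL2C.coe_inv_eq, h ρ]
    simp only [traceCoords, mul_add, mul_smul_comm, mul_one, ← mul_assoc,
      mul_comm_fin_two (ρ (x m n)).1 (ρ (y m n)).1, sub_mul, add_mul, smul_mul_assoc, one_mul]
    simp only [mul_assoc, mul_self_of_det_eq_one (ρ (y m n)).2, mul_sub, mul_smul_comm, mul_one]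
    module

lemma exists_traceFun (g : TorusGroup m n) :
    ∃ F : ℂ × ℂ × ℂ → ℂ, Continuous F ∧
      ∀ ρ : TorusGroup m n →* SL2C, (ρ g).1.trace = F (traceCoords ρ) := by
  obtain ⟨a, b, c, d, ⟨ha, hb, hc, hd⟩, h⟩ := exists_normalForm g
  refine ⟨fun z => 2 * a z + b z * z.1 + c z * z.2.1 + d z * z.2.2, by fun_prop, fun ρ => ?_⟩
  rw [h ρ]
  simp only [trace_add, trace_smul, trace_one, Fintype.card_fin, smul_eq_mul, traceCoords]
  push_cast
  ring

lemma charPoint_eq_of_traceCoords_eq {ρ σ : TorusGroup m n →* SL2C}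
    (h : traceCoords ρ = traceCoords σ) : charPoint ρ = charPoint σ := by
  apply Subtype.ext
  funext g
  obtain ⟨F, -, hF⟩ := exists_traceFun g
  exact (hF ρ).trans ((congrArg F h).trans (hF σ).symm)

lemma traceCoords_eq_of_charPoint_eq {ρ σ : TorusGroup m n →* SL2C}
    (h : charPoint ρ = charPoint σ) : traceCoords ρ = traceCoords σ := by
  have h' : ∀ g, (ρ g).1.trace = (σ g).1.trace := fun g => congrFun (congrArg Subtype.val h) g
  have hxy := h' (x m n * y m n)
  rw [map_mul, map_mul, SL2C.coe_mul_eq, SL2C.coe_mul_eq] at hxy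
  simp only [traceCoords, h', hxy]

lemma continuous_charPoint {T : Type*} [TopologicalSpace T] {ρ : T → TorusGroup m n →* SL2C}
    (h : Continuous fun t => traceCoords (ρ t)) : Continuous fun t => charPoint (ρ t) := by
  refine Continuous.subtype_mk (continuous_pi fun g => ?_) _
  obtain ⟨F, hF, hF'⟩ := exists_traceFun g
  simp only [hF']
  exact hF.comp h

end NormalForm

/-! ### Reducibility and the commutator -/

section Irreducibility

open Matrix TorusGroup

variable {m n : ℕ}

/-- An invariant line is spanned by a common eigenvector, which the commutator kills. -/
lemma det_commutator_eq_zero_of_not_irreducible {ρ : TorusGroup m n →* SL2C}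
    (h : ¬ (linRep ρ).IsIrreducible) :
    ((ρ (x m n)).1 * (ρ (y m n)).1 - (ρ (y m n)).1 * (ρ (x m n)).1).det = 0 := by
  have hnt : Nontrivial (Subrepresentation (linRep ρ)) := by
    refine ⟨⊥, ⊤, fun e => ?_⟩
    have h1 : (⊥ : Submodule ℂ (Fin 2 → ℂ)) = ⊤ := congrArg Subrepresentation.toSubmodule e
    exact bot_ne_top h1
  obtain ⟨W, hW0, hW1⟩ : ∃ W : Subrepresentation (linRep ρ), W ≠ ⊥ ∧ W ≠ ⊤ := by
    by_contra! hc
    exact h ⟨fun W => or_iff_not_imp_left.2 (hc W)⟩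
  have h0 : W.toSubmodule ≠ ⊥ := fun e => hW0 (Subrepresentation.toSubmodule_injective e)
  have h1 : W.toSubmodule ≠ ⊤ := fun e => hW1 (Subrepresentation.toSubmodule_injective e)
  obtain ⟨v, hv, hv0⟩ := Submodule.exists_mem_ne_zero_of_ne_bot h0
  have hfin : Module.finrank ℂ W.toSubmodule = 1 := by
    have hlt := Submodule.finrank_lt h1
    have hpos : Module.finrank ℂ W.toSubmodule ≠ 0 := fun e => h0 (Submodule.finrank_eq_zero.1 e)
    simp only [Module.finrank_fin_fun] at hlt
    omega
  have key : ∀ g, ∃ c : ℂ, (ρ g).1 *ᵥ v = c • v := by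
    intro g
    obtain ⟨c, hc⟩ := (finrank_eq_one_iff_of_nonzero' (⟨v, hv⟩ : W.toSubmodule)
      (by simpa [Subtype.ext_iff] using hv0)).1 hfin ⟨_, W.apply_mem_toSubmodule g hv⟩
    exact ⟨c, (congrArg Subtype.val hc).symm⟩
  obtain ⟨a, ha⟩ := key (x m n)
  obtain ⟨b, hb⟩ := key (y m n)
  refine exists_mulVec_eq_zero_iff.1 ⟨v, hv0, ?_⟩
  rw [sub_mulVec, ← mulVec_mulVec, ← mulVec_mulVec, ha, hb, mulVec_smul, mulVec_smul, ha, hb,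
    smul_comm, sub_self]

/-- An eigenspace of `x` is invariant under everything commuting with `x`. It is proper, since a
scalar `l` of determinant one would have `l ^ 2 = 1`. -/
lemma not_irreducible_of_commute {ρ : TorusGroup m n →* SL2C} {l : ℂ}
    (hxy : (ρ (x m n)).1 * (ρ (y m n)).1 = (ρ (y m n)).1 * (ρ (x m n)).1)
    (hl : Module.End.HasEigenvalue (toLin' (ρ (x m n)).1) l) (hl1 : l ^ 2 ≠ 1) :
    ¬ (linRep ρ).IsIrreducible := by
  intro hirr
  have hcomm : ∀ g, (ρ (x m n)).1 * (ρ g).1 = (ρ g).1 * (ρ (x m n)).1 := by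
    intro g
    obtain ⟨a, b, c, d, -, h⟩ := exists_normalForm g
    have hxxy : (ρ (x m n)).1 * ((ρ (x m n)).1 * (ρ (y m n)).1)
        = (ρ (x m n)).1 * (ρ (y m n)).1 * (ρ (x m n)).1 := by rw [mul_assoc, ← hxy]
    rw [h ρ]
    simp only [mul_add, add_mul, mul_smul_comm, smul_mul_assoc, mul_one, one_mul, hxxy]
    rw [hxy]
  let W : Subrepresentation (linRep ρ) :=
    { toSubmodule := Module.End.eigenspace (toLin' (ρ (x m n)).1) l
      apply_mem_toSubmodule := by
        intro g v hv
        rw [Module.End.mem_eigenspace_iff] at hv ⊢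
        change (ρ (x m n)).1 *ᵥ ((ρ g).1 *ᵥ v) = l • ((ρ g).1 *ᵥ v)
        change (ρ (x m n)).1 *ᵥ v = l • v at hv
        rw [mulVec_mulVec, hcomm, ← mulVec_mulVec, hv, mulVec_smul] }
  rcases hirr.eq_bot_or_eq_top W with e | e
  · exact hl (congrArg Subrepresentation.toSubmodule e)
  · have htop : Module.End.eigenspace (toLin' (ρ (x m n)).1) l = ⊤ :=
      congrArg Subrepresentation.toSubmodule e
    have hX : (ρ (x m n)).1 = l • (1 : Matrix (Fin 2) (Fin 2) ℂ) := by
      apply toLin'.injective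
      ext1 i
      ext1
      have hmem : Pi.single i (1 : ℂ) ∈ Module.End.eigenspace (toLin' (ρ (x m n)).1) l := by
        rw [htop]; trivial
      rw [Module.End.mem_eigenspace_iff] at hmem
      simpa using hmem
    have hdet := (ρ (x m n)).2
    rw [hX, det_smul, det_one, mul_one, Fintype.card_fin] at hdet
    exact hl1 hdet

end Irreducibility

/-! ### `SU(2)` as unit quaternions -/

section Unitary

open Matrix

lemma SU2.star_eq_adjugate (A : SU2) : star A.1 = A.1.adjugate := by
  have h1 : star A.1 * A.1 = 1 := mem_unitaryGroup_iff'.1 (mem_specialUnitaryGroup_iff.1 A.2).1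
  have h2 : A.1 * A.1.adjugate = 1 := by
    rw [mul_adjugate, (mem_specialUnitaryGroup_iff.1 A.2).2, one_smul]
  exact left_inv_eq_right_inv h1 h2

/-- The entries of a matrix in `SU(2)` are those of a unit quaternion. -/
lemma SU2.exists_entries (A : SU2) : ∃ a b c d : ℝ, a ^ 2 + b ^ 2 + c ^ 2 + d ^ 2 = 1 ∧
    A.1 = !![a + b * Complex.I, c + d * Complex.I; -c + d * Complex.I, a - b * Complex.I] := by
  have h := SU2.star_eq_adjugate A
  have hdet := (mem_specialUnitaryGroup_iff.1 A.2).2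
  rw [det_fin_two] at hdet
  rw [adjugate_fin_two] at h
  have h00 := congrFun (congrFun h 0) 0
  have h01 := congrFun (congrFun h 1) 0
  simp [star_apply] at h00 h01
  have h11 : A.1 1 1 = (A.1 0 0).re - (A.1 0 0).im * Complex.I := by
    rw [← h00]; apply Complex.ext <;> simp
  have h10 : A.1 1 0 = -(A.1 0 1).re + (A.1 0 1).im * Complex.I := by
    rw [eq_neg_iff_add_eq_zero.2 (neg_eq_iff_add_eq_zero.1 h01.symm)]
    apply Complex.ext <;> simp
  refine ⟨(A.1 0 0).re, (A.1 0 0).im, (A.1 0 1).re, (A.1 0 1).im, ?_, ?_⟩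
  · rw [h11, h10] at hdet
    have := congrArg Complex.re hdet
    simp at this
    linear_combination this
  · ext i j
    fin_cases i <;> fin_cases j <;> simp [h11, h10]

/-- The traces of two elements of `SU(2)` with eigenvalues `exp (± i α)`, `exp (± i β)` and of their
product are related by the angle between the two rotation axes. -/
lemma SU2.exists_angle (A B : SU2) {α β : ℝ} (hα : 0 < Real.sin α) (hβ : 0 < Real.sin β)
    (hA : A.1.trace = 2 * Real.cos α) (hB : B.1.trace = 2 * Real.cos β) :
    ∃ φ ∈ Set.Icc 0 Real.pi, (A.1 * B.1).trace =
      2 * (Real.cos α * Real.cos β - Real.sin α * Real.sin β * Real.cos φ) := by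
  obtain ⟨a, b, c, d, h, hAe⟩ := SU2.exists_entries A
  obtain ⟨p, q, r, s, h', hBe⟩ := SU2.exists_entries B
  have ha : a = Real.cos α := by
    rw [hAe, trace_fin_two_of] at hA
    have := congrArg Complex.re hA
    simp [-Complex.ofReal_cos] at this
    linarith
  have hp : p = Real.cos β := by
    rw [hBe, trace_fin_two_of] at hB
    have := congrArg Complex.re hB
    simp [-Complex.ofReal_cos] at this
    linarith
  -- The vector parts `(b, c, d)` and `(q, r, s)` have lengths `sin α` and `sin β`.
  have hv : b ^ 2 + c ^ 2 + d ^ 2 = Real.sin α ^ 2 := by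
    rw [ha] at h; linear_combination h - Real.sin_sq_add_cos_sq α
  have hw : q ^ 2 + r ^ 2 + s ^ 2 = Real.sin β ^ 2 := by
    rw [hp] at h'; linear_combination h' - Real.sin_sq_add_cos_sq β
  have hpos : 0 < Real.sin α * Real.sin β := mul_pos hα hβ
  have hle : |b * q + c * r + d * s| ≤ Real.sin α * Real.sin β := by
    refine abs_le_of_sq_le_sq ?_ hpos.le
    rw [mul_pow, ← hv, ← hw]
    -- Cauchy–Schwarz through Lagrange's identity.
    nlinarith [sq_nonneg (b * r - c * q), sq_nonneg (b * s - d * q), sq_nonneg (c * s - d * r)]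
  obtain ⟨hl, hu⟩ := abs_le.1 hle
  refine ⟨Real.arccos ((b * q + c * r + d * s) / (Real.sin α * Real.sin β)),
    ⟨Real.arccos_nonneg _, Real.arccos_le_pi _⟩, ?_⟩
  rw [Real.cos_arccos (by rw [le_div_iff₀ hpos]; linarith) (by rw [div_le_one hpos]; exact hu)]
  rw [← Complex.ofReal_mul (Real.sin α), ← Complex.ofReal_mul (Real.sin α * Real.sin β),
    mul_div_cancel₀ _ hpos.ne', ← ha, ← hp, hAe, hBe, trace_fin_two]
  simp [Matrix.mul_apply, Fin.sum_univ_two]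
  linear_combination (2 * b * q + 2 * d * s : ℂ) * Complex.I_sq

/-- The rotation `cos θ + i sin θ (cos φ σ_z + sin φ σ_x)` in `SU(2)`. -/
noncomputable def SU2.rotation (θ φ : ℝ) : SU2 :=
  ⟨!![Real.cos θ + Complex.I * Real.sin θ * Real.cos φ, Complex.I * Real.sin θ * Real.sin φ;
      Complex.I * Real.sin θ * Real.sin φ, Real.cos θ - Complex.I * Real.sin θ * Real.cos φ], by
    have h1 : (Real.sin θ : ℂ) ^ 2 + (Real.cos θ : ℂ) ^ 2 = 1 := mod_cast Real.sin_sq_add_cos_sq θ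
    have h2 : (Real.sin φ : ℂ) ^ 2 + (Real.cos φ : ℂ) ^ 2 = 1 := mod_cast Real.sin_sq_add_cos_sq φ
    have hI := Complex.I_sq
    generalize hs : (Real.sin θ : ℂ) = s at h1
    generalize hc : (Real.cos θ : ℂ) = c at h1
    generalize hS : (Real.sin φ : ℂ) = S at h2
    generalize hC : (Real.cos φ : ℂ) = C at h2
    have ks : (starRingEnd ℂ) s = s := by rw [← hs, Complex.conj_ofReal]
    have kc : (starRingEnd ℂ) c = c := by rw [← hc, Complex.conj_ofReal]
    have kS : (starRingEnd ℂ) S = S := by rw [← hS, Complex.conj_ofReal]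
    have kC : (starRingEnd ℂ) C = C := by rw [← hC, Complex.conj_ofReal]
    rw [mem_specialUnitaryGroup_iff, mem_unitaryGroup_iff]
    constructor
    · ext i j
      fin_cases i <;> fin_cases j <;>
        simp [Matrix.mul_apply, Fin.sum_univ_two, star_apply, ks, kc, kS, kC] <;>
        first
        | ring1
        | linear_combination h1 + s ^ 2 * h2 - s ^ 2 * (S ^ 2 + C ^ 2) * hI
    · rw [det_fin_two_of]
      linear_combination h1 + s ^ 2 * h2 - s ^ 2 * (S ^ 2 + C ^ 2) * hI⟩

lemma SU2.rotation_mul (θ θ' φ : ℝ) :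
    SU2.rotation θ φ * SU2.rotation θ' φ = SU2.rotation (θ + θ') φ := by
  apply Subtype.ext
  have h2 : (Real.sin φ : ℂ) ^ 2 + (Real.cos φ : ℂ) ^ 2 = 1 := mod_cast Real.sin_sq_add_cos_sq φ
  change (SU2.rotation θ φ).1 * (SU2.rotation θ' φ).1 = _
  have hI := Complex.I_sq
  simp only [SU2.rotation, Real.cos_add, Real.sin_add, Complex.ofReal_add, Complex.ofReal_sub,
    Complex.ofReal_mul]
  ext i j
  fin_cases i <;> fin_cases j <;>
    simp [-Complex.ofReal_cos, -Complex.ofReal_sin, Matrix.mul_apply, Fin.sum_univ_two] <;>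
    first
    | ring1
    | linear_combination (Real.sin θ * Real.sin θ' : ℂ) *
        ((Real.sin φ ^ 2 + Real.cos φ ^ 2 : ℂ) * hI - h2)

lemma SU2.rotation_pow (θ φ : ℝ) (n : ℕ) : SU2.rotation θ φ ^ n = SU2.rotation (n * θ) φ := by
  induction n with
  | zero =>
    apply Subtype.ext
    rw [pow_zero]
    change (1 : Matrix (Fin 2) (Fin 2) ℂ) = _
    simp [SU2.rotation, one_fin_two]
  | succ n ih => rw [pow_succ, ih, SU2.rotation_mul]; push_cast; ring_nf

lemma SU2.rotation_nat_mul_pi (k : ℕ) (φ : ℝ) :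
    (SU2.rotation (k * Real.pi) φ).1 = (-1 : ℂ) ^ k • (1 : Matrix (Fin 2) (Fin 2) ℂ) := by
  simp only [SU2.rotation, Real.cos_nat_mul_pi, Real.sin_nat_mul_pi]
  simp [one_fin_two, smul_of]

lemma SU2.trace_rotation (θ φ : ℝ) : (SU2.rotation θ φ).1.trace = 2 * Real.cos θ := by
  simp only [SU2.rotation, trace_fin_two_of]; ring

lemma SU2.trace_rotation_mul (α β φ : ℝ) : ((SU2.rotation α 0).1 * (SU2.rotation β φ).1).trace =
    2 * (Real.cos α * Real.cos β - Real.sin α * Real.sin β * Real.cos φ) := by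
  rw [trace_fin_two]
  simp [SU2.rotation, Matrix.mul_apply, Fin.sum_univ_two]
  linear_combination
    (2 * Complex.sin α * Complex.sin β * Complex.cos φ) * Complex.I_sq

lemma SU2.rotation_zero_right (θ : ℝ) : (SU2.rotation θ 0).1 =
    diagonal ![Complex.exp (θ * Complex.I), (Complex.exp (θ * Complex.I))⁻¹] := by
  rw [← Complex.exp_neg, ← neg_mul, ← Complex.ofReal_neg, Complex.exp_mul_I, Complex.exp_mul_I]
  ext i j
  fin_cases i <;> fin_cases j <;> simp [SU2.rotation] <;> ring

lemma SU2.rotation_pi_right (θ : ℝ) : (SU2.rotation θ Real.pi).1 =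
    diagonal ![(Complex.exp (θ * Complex.I))⁻¹, Complex.exp (θ * Complex.I)] := by
  rw [← Complex.exp_neg, ← neg_mul, ← Complex.ofReal_neg, Complex.exp_mul_I, Complex.exp_mul_I]
  ext i j
  fin_cases i <;> fin_cases j <;> simp [SU2.rotation] <;> ring

/-- A matrix of determinant one has the eigenvalue `exp (i θ)` iff its trace is `2 cos θ`. -/
lemma hasEigenvalue_exp_iff {A : Matrix (Fin 2) (Fin 2) ℂ} (hA : A.det = 1) (θ : ℝ) :
    Module.End.HasEigenvalue (toLin' A) (Complex.exp (θ * Complex.I)) ↔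
      A.trace = 2 * Real.cos θ := by
  have h0 := Complex.exp_ne_zero (θ * Complex.I)
  have h2 : (2 * Real.cos θ : ℂ) =
      Complex.exp (θ * Complex.I) + (Complex.exp (θ * Complex.I))⁻¹ := by
    rw [Complex.ofReal_cos, Complex.two_cos, ← Complex.exp_neg, neg_mul]
  rw [hasEigenvalue_toLin'_fin_two, hA, h2]
  constructor
  · intro h
    field_simp
    linear_combination -h
  · intro h
    rw [h]
    field_simp
    ring

end Unitary

/-! ### The arc of representations -/

section Arc

open Matrix TorusGroup

variable {m n : ℕ}

/-- The homomorphism from the torus group to `SU(2)` with given images of the generators. -/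
def TorusGroup.lift (A B : SU2) (h : A ^ m = B ^ n) : TorusGroup m n →* SU2 :=
  PresentedGroup.toGroup (f := ![A, B]) (by
    rintro r rfl
    simp [h])

@[simp] lemma TorusGroup.lift_x (A B : SU2) (h : A ^ m = B ^ n) : lift A B h (x m n) = A :=
  PresentedGroup.toGroup.of _

@[simp] lemma TorusGroup.lift_y (A B : SU2) (h : A ^ m = B ^ n) : lift A B h (y m n) = B :=
  PresentedGroup.toGroup.of _

/-- Both powers are rotations by multiples of `π`, hence `± 1` whatever the axis; parity makes the
signs agree. -/
lemma rotation_relation {k k' : ℕ} (hm : m ≠ 0) (hn : n ≠ 0) (hkk : k ≡ k' [MOD 2]) (φ : ℝ) :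
    SU2.rotation (Real.pi * k / m) 0 ^ m = SU2.rotation (Real.pi * k' / n) φ ^ n := by
  have hm' : (m : ℝ) ≠ 0 := mod_cast hm
  have hn' : (n : ℝ) ≠ 0 := mod_cast hn
  rw [SU2.rotation_pow, SU2.rotation_pow]
  apply Subtype.ext
  rw [show m * (Real.pi * k / m) = k * Real.pi by field_simp,
    show n * (Real.pi * k' / n) = k' * Real.pi by field_simp,
    SU2.rotation_nat_mul_pi, SU2.rotation_nat_mul_pi,
    neg_one_pow_eq_pow_mod_two, hkk, ← neg_one_pow_eq_pow_mod_two]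

lemma eigVal_eq (m k : ℕ) : eigVal m k = Complex.exp ((Real.pi * k / m : ℝ) * Complex.I) := by
  rw [eigVal]; congr 1; push_cast; ring

lemma sin_pi_mul_div_pos {m k : ℕ} (hk : 0 < k) (hkm : k < m) :
    0 < Real.sin (Real.pi * k / m) := by
  have hm : (0 : ℝ) < m := mod_cast hk.trans hkm
  have hk' : (0 : ℝ) < k := mod_cast hk
  apply Real.sin_pos_of_pos_of_lt_pi
  · have := Real.pi_pos; positivity
  · rw [div_lt_iff₀ hm]
    exact mul_lt_mul_of_pos_left (mod_cast hkm) Real.pi_pos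

lemma eigVal_sq_ne_one {m k : ℕ} (hk : 0 < k) (hkm : k < m) : eigVal m k ^ 2 ≠ 1 := by
  intro h
  have hs := sin_pi_mul_div_pos hk hkm
  rw [← Complex.exp_ofReal_mul_I_im, ← eigVal_eq] at hs
  rcases eq_or_eq_neg_of_sq_eq_sq _ 1 (h.trans (one_pow 2).symm) with h | h <;> simp [h] at hs

/-- The determinant of the commutator of two rotations. -/
lemma det_commutator_of_traces {A B : Matrix (Fin 2) (Fin 2) ℂ} (hA : A.det = 1) (hB : B.det = 1)
    {α β φ : ℝ} (htA : A.trace = 2 * Real.cos α) (htB : B.trace = 2 * Real.cos β)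
    (htAB : (A * B).trace =
      2 * (Real.cos α * Real.cos β - Real.sin α * Real.sin β * Real.cos φ)) :
    (A * B - B * A).det = ((2 * Real.sin α * Real.sin β * Real.sin φ : ℝ) : ℂ) ^ 2 := by
  rw [det_commutator hA hB, htA, htB, htAB]
  norm_cast
  have h1 := Real.sin_sq_add_cos_sq α
  have h2 := Real.sin_sq_add_cos_sq β
  have h3 := Real.sin_sq_add_cos_sq φ
  rw [← eq_sub_iff_add_eq] at h1 h2 h3
  simp only [mul_pow, mul_sub, sub_sq, h3]
  ring_nf
  simp only [h1, h2]
  ring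

/-- Two elements of `SU(2)` commute as soon as their commutator is singular. -/
lemma SU2.mul_comm_of_det_eq_zero (A B : SU2) (h : (A.1 * B.1 - B.1 * A.1).det = 0) :
    A.1 * B.1 = B.1 * A.1 := by
  obtain ⟨a, b, c, d, -, hA⟩ := SU2.exists_entries A
  obtain ⟨p, q, r, s, -, hB⟩ := SU2.exists_entries B
  -- The commutator is twice the cross product of the vector parts; its determinant is a sum of
  -- three real squares.
  have hM : A.1 * B.1 - B.1 * A.1 =
      !![((2 * (c * s - d * r) : ℝ) : ℂ) * Complex.I,
          ((2 * (d * q - b * s) : ℝ) : ℂ) + ((2 * (b * r - c * q) : ℝ) : ℂ) * Complex.I;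
        -((2 * (d * q - b * s) : ℝ) : ℂ) + ((2 * (b * r - c * q) : ℝ) : ℂ) * Complex.I,
          -((2 * (c * s - d * r) : ℝ) : ℂ) * Complex.I] := by
    rw [hA, hB]
    ext i j
    fin_cases i <;> fin_cases j <;> apply Complex.ext <;>
      simp <;> ring
  rw [hM, det_fin_two_of] at h
  have hre := congrArg Complex.re h
  simp at hre
  have h1 : c * s - d * r = 0 := by
    nlinarith [sq_nonneg (c * s - d * r), sq_nonneg (d * q - b * s), sq_nonneg (b * r - c * q)]
  have h2 : d * q - b * s = 0 := by
    nlinarith [sq_nonneg (c * s - d * r), sq_nonneg (d * q - b * s), sq_nonneg (b * r - c * q)]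
  have h3 : b * r - c * q = 0 := by
    nlinarith [sq_nonneg (c * s - d * r), sq_nonneg (d * q - b * s), sq_nonneg (b * r - c * q)]
  rw [← sub_eq_zero, hM, h1, h2, h3]
  ext i j
  fin_cases i <;> fin_cases j <;> simp

/-- The arc of `SU(2)`-representations obtained by turning the rotation axis of the image of `y`
by the angle `φ` away from the axis of the image of `x`. -/
noncomputable def arcRep {k k' : ℕ} (hm : m ≠ 0) (hn : n ≠ 0) (hkk : k ≡ k' [MOD 2]) (φ : ℝ) :
    TorusGroup m n →* SU2 :=
  lift (SU2.rotation (Real.pi * k / m) 0) (SU2.rotation (Real.pi * k' / n) φ)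
    (rotation_relation hm hn hkk φ)

section

variable {k k' : ℕ} (hm : m ≠ 0) (hn : n ≠ 0) (hkk : k ≡ k' [MOD 2])

/-- The trace coordinates on the arc. -/
noncomputable def arcCoords (m n k k' : ℕ) (φ : ℝ) : ℂ × ℂ × ℂ :=
  (2 * Real.cos (Real.pi * k / m), 2 * Real.cos (Real.pi * k' / n),
    2 * (Real.cos (Real.pi * k / m) * Real.cos (Real.pi * k' / n) -
      Real.sin (Real.pi * k / m) * Real.sin (Real.pi * k' / n) * Real.cos φ))

lemma coe_inclSU2_comp (ρ : TorusGroup m n →* SU2) (g : TorusGroup m n) :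
    ((inclSU2.comp ρ) g).1 = (ρ g).1 := rfl

lemma traceCoords_inclSU2 (ρ : TorusGroup m n →* SU2) :
    traceCoords (inclSU2.comp ρ) =
      ((ρ (x m n)).1.trace, (ρ (y m n)).1.trace, ((ρ (x m n)).1 * (ρ (y m n)).1).trace) := rfl

lemma traceCoords_arcRep (φ : ℝ) :
    traceCoords (inclSU2.comp (arcRep hm hn hkk φ)) = arcCoords m n k k' φ := by
  rw [traceCoords_inclSU2, arcRep, lift_x, lift_y, SU2.trace_rotation, SU2.trace_rotation,
    SU2.trace_rotation_mul, arcCoords]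

lemma charPointSU2_eq_arc_iff (ρ : TorusGroup m n →* SU2) (φ : ℝ) :
    charPointSU2 ρ = charPointSU2 (arcRep hm hn hkk φ) ↔
      traceCoords (inclSU2.comp ρ) = arcCoords m n k k' φ := by
  rw [← traceCoords_arcRep hm hn hkk]
  exact ⟨traceCoords_eq_of_charPoint_eq, charPoint_eq_of_traceCoords_eq⟩

lemma hasEigenvalue_eigVal_iff (A : SU2) (m k : ℕ) :
    Module.End.HasEigenvalue (toLin' A.1) (eigVal m k) ↔
      A.1.trace = 2 * Real.cos (Real.pi * k / m) := by
  rw [eigVal_eq, hasEigenvalue_exp_iff (mem_specialUnitaryGroup_iff.1 A.2).2]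

/-- On the arc, exactly the interior points are irreducible. -/
lemma irredSU2_iff_sin_ne_zero (hk : 0 < k) (hkm : k < m) (hk' : 0 < k') (hkn : k' < n)
    {ρ : TorusGroup m n →* SU2} {φ : ℝ}
    (h : traceCoords (inclSU2.comp ρ) = arcCoords m n k k' φ) :
    IrredSU2 ρ ↔ Real.sin φ ≠ 0 := by
  simp only [traceCoords_inclSU2, arcCoords, Prod.mk.injEq] at h
  obtain ⟨hX, hY, hXY⟩ := h
  have hdet := det_commutator_of_traces (mem_specialUnitaryGroup_iff.1 (ρ (x m n)).2).2
    (mem_specialUnitaryGroup_iff.1 (ρ (y m n)).2).2 hX hY hXY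
  have hα := sin_pi_mul_div_pos hk hkm
  have hβ := sin_pi_mul_div_pos hk' hkn
  constructor
  · intro hirr hφ
    rw [hφ] at hdet
    have hcomm := SU2.mul_comm_of_det_eq_zero (ρ (x m n)) (ρ (y m n)) (by rw [hdet]; simp)
    have hl := (hasEigenvalue_eigVal_iff (ρ (x m n)) m k).2 hX
    rw [← coe_inclSU2_comp] at hl
    rw [← coe_inclSU2_comp, ← coe_inclSU2_comp] at hcomm
    exact not_irreducible_of_commute hcomm hl (eigVal_sq_ne_one hk hkm) hirr
  · intro hφ
    by_contra hirr
    have h0 := det_commutator_eq_zero_of_not_irreducible hirr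
    simp only [coe_inclSU2_comp] at h0
    rw [hdet, sq_eq_zero_iff, Complex.ofReal_eq_zero] at h0
    exact mul_ne_zero (by positivity) hφ h0

lemma mem_YIrrComp_iff (hk : 0 < k) (hkm : k < m) (hk' : 0 < k') (hkn : k' < n)
    (χ : CharVariety (TorusGroup m n)) :
    χ ∈ YIrrComp m n k k' ↔
      ∃ φ ∈ Set.Ioo 0 Real.pi, χ = charPointSU2 (arcRep hm hn hkk φ) := by
  constructor
  · rintro ⟨ρ, hirr, hx, hy, rfl⟩
    rw [hasEigenvalue_eigVal_iff] at hx hy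
    obtain ⟨φ, ⟨h0, h1⟩, hφ⟩ := SU2.exists_angle _ _ (sin_pi_mul_div_pos hk hkm)
      (sin_pi_mul_div_pos hk' hkn) hx hy
    have hc : traceCoords (inclSU2.comp ρ) = arcCoords m n k k' φ := by
      rw [traceCoords_inclSU2, hx, hy, hφ, arcCoords]
    have hs := (irredSU2_iff_sin_ne_zero hk hkm hk' hkn hc).1 hirr
    refine ⟨φ, ⟨h0.lt_of_ne ?_, h1.lt_of_ne ?_⟩, (charPointSU2_eq_arc_iff hm hn hkk ρ φ).2 hc⟩
    · rintro rfl; simp at hs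
    · rintro rfl; simp at hs
  · rintro ⟨φ, hφ, rfl⟩
    have hc := traceCoords_arcRep hm hn hkk φ
    refine ⟨_, (irredSU2_iff_sin_ne_zero hk hkm hk' hkn hc).2
      (Real.sin_pos_of_mem_Ioo hφ).ne', ?_, ?_, rfl⟩
    · rw [hasEigenvalue_eigVal_iff]; exact congrArg Prod.fst hc
    · rw [hasEigenvalue_eigVal_iff]; exact congrArg (fun z => z.2.1) hc

lemma continuous_arc : Continuous fun φ => charPointSU2 (arcRep hm hn hkk φ) := by
  refine continuous_charPoint ?_
  simp only [traceCoords_arcRep, arcCoords]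
  fun_prop

/-- The third coordinate recovers `cos φ`, because `sin α sin β > 0`. -/
lemma injOn_arc (hk : 0 < k) (hkm : k < m) (hk' : 0 < k') (hkn : k' < n) :
    Set.InjOn (fun φ => charPointSU2 (arcRep hm hn hkk φ)) (Set.Icc 0 Real.pi) := by
  intro φ hφ ψ hψ h
  have hα := sin_pi_mul_div_pos hk hkm
  have hβ := sin_pi_mul_div_pos hk' hkn
  have h' := (charPointSU2_eq_arc_iff hm hn hkk _ ψ).1 h
  rw [traceCoords_arcRep, arcCoords, arcCoords, Prod.mk.injEq, Prod.mk.injEq] at h'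
  have h2 := h'.2.2
  norm_cast at h2
  apply Real.injOn_cos hφ hψ
  apply mul_left_cancel₀ (mul_pos hα hβ).ne'
  linarith

lemma isDiagChar_arc_zero :
    IsDiagChar (charPointSU2 (arcRep hm hn hkk 0)) (eigVal m k) (eigVal n k') := by
  refine ⟨_, ?_, ?_, rfl⟩
  · rw [arcRep, lift_x, SU2.rotation_zero_right, eigVal_eq]
  · rw [arcRep, lift_y, SU2.rotation_zero_right, eigVal_eq]

/-- At `φ = π` the axis of `y` is reversed, which swaps its two eigenvalues. -/
lemma isDiagChar_arc_pi :
    IsDiagChar (charPointSU2 (arcRep hm hn hkk Real.pi)) (eigVal m k) (eigVal n k')⁻¹ := by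
  refine ⟨_, ?_, ?_, rfl⟩
  · rw [arcRep, lift_x, SU2.rotation_zero_right, eigVal_eq]
  · rw [arcRep, lift_y, SU2.rotation_pi_right, eigVal_eq, inv_inv]

end

lemma eigVal_pow_div_gcd (k : ℕ) (hm : m ≠ 0) {d : ℕ} (hd : d ∣ m) :
    eigVal m k ^ (m / d) = Complex.exp (Real.pi * Complex.I * k / d) := by
  obtain ⟨a, rfl⟩ := hd
  obtain ⟨hd0, ha0⟩ := mul_ne_zero_iff.1 hm
  have h1 : (d : ℂ) ≠ 0 := mod_cast hd0
  have h2 : (a : ℂ) ≠ 0 := mod_cast ha0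
  rw [Nat.mul_div_cancel_left _ (Nat.pos_of_ne_zero hd0), eigVal, ← Complex.exp_nat_mul]
  congr 1
  push_cast
  field_simp

lemma exp_two_pi_div_zpow_of_modEq {d : ℕ} (hd : d ≠ 0) {i j : ℤ} (h : i ≡ j [ZMOD d]) :
    Complex.exp (2 * Real.pi * Complex.I / d) ^ i =
      Complex.exp (2 * Real.pi * Complex.I / d) ^ j := by
  obtain ⟨c, hc⟩ := h.dvd
  have h1 : (d : ℂ) ≠ 0 := mod_cast hd
  have hp : Complex.exp (2 * Real.pi * Complex.I / d) ^ (d : ℤ) = 1 := by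
    rw [← Complex.exp_int_mul, Int.cast_natCast, mul_div_cancel₀ _ h1, Complex.exp_two_pi_mul_I]
  rw [eq_add_of_sub_eq hc, zpow_add₀ (Complex.exp_ne_zero _), _root_.zpow_mul, hp,
    _root_.one_zpow, one_mul]

end Arc

/-! ### Indices of the endpoints and the main theorem -/

section Main

open TorusGroup

/-- With `d = gcd (m, n)`, the powers are `λ ^ a = exp (π i k / d)` and `μ ^ b = exp (π i k' / d)`,
with quotient `ξ ^ ((k - k') / 2)`; parity makes the integer division exact. -/
lemma isDiagChar_mem_YRedComp {m n k k' : ℕ} (hm : m ≠ 0) (hn : n ≠ 0)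
    {χ : CharVariety (TorusGroup m n)} {i : ℤ}
    (hi : i ≡ ((k : ℤ) - (k' : ℤ)) / 2 [ZMOD (m.gcd n : ℤ)]) (hkk : k ≡ k' [MOD 2])
    (h : IsDiagChar χ (eigVal m k) (eigVal n k')) : χ ∈ YRedComp m n i := by
  refine ⟨_, _, ?_, h⟩
  have hd : m.gcd n ≠ 0 := Nat.gcd_ne_zero_left hm
  have hd' : (m.gcd n : ℂ) ≠ 0 := mod_cast hd
  obtain ⟨j, hj⟩ : ∃ j : ℤ, (k : ℤ) - k' = 2 * j := hkk.symm.dvd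
  have hjC : (k : ℂ) - k' = 2 * j := mod_cast hj
  rw [eigVal_pow_div_gcd k hm (Nat.gcd_dvd_left m n),
    eigVal_pow_div_gcd k' hn (Nat.gcd_dvd_right m n),
    exp_two_pi_div_zpow_of_modEq hd hi, hj, Int.mul_ediv_cancel_left _ two_ne_zero,
    ← Complex.exp_int_mul, ← Complex.exp_add]
  congr 1
  field_simp
  linear_combination hjC

lemma isDiagChar_inv_mem_YRedComp {m n k k' : ℕ} (hm : m ≠ 0) (hn : n ≠ 0)
    {χ : CharVariety (TorusGroup m n)} {i : ℤ}
    (hi : i ≡ ((k : ℤ) + (k' : ℤ)) / 2 [ZMOD (m.gcd n : ℤ)]) (hkk : k ≡ k' [MOD 2])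
    (h : IsDiagChar χ (eigVal m k) (eigVal n k')⁻¹) : χ ∈ YRedComp m n i := by
  refine ⟨_, _, ?_, h⟩
  have hd : m.gcd n ≠ 0 := Nat.gcd_ne_zero_left hm
  have hd' : (m.gcd n : ℂ) ≠ 0 := mod_cast hd
  obtain ⟨j, hj⟩ : ∃ j : ℤ, (k : ℤ) + k' = 2 * j := by
    obtain ⟨j, hj⟩ := hkk.symm.dvd
    exact ⟨j + k', by push_cast at hj; linarith⟩
  have hjC : (k : ℂ) + k' = 2 * j := mod_cast hj
  rw [inv_pow, eigVal_pow_div_gcd k hm (Nat.gcd_dvd_left m n),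
    eigVal_pow_div_gcd k' hn (Nat.gcd_dvd_right m n),
    exp_two_pi_div_zpow_of_modEq hd hi, hj, Int.mul_ediv_cancel_left _ two_ne_zero,
    ← Complex.exp_int_mul, ← Complex.exp_neg, ← Complex.exp_add]
  congr 1
  field_simp
  linear_combination hjC

theorem proposition11 (m n k k' : ℕ) (hk : 0 < k) (hkm : k < m) (hk' : 0 < k') (hkn : k' < n)
    (hkk : k ≡ k' [MOD 2]) (i₀ i₁ : ℤ)
    (hi₀ : i₀ ≡ ((k : ℤ) - (k' : ℤ)) / 2 [ZMOD (m.gcd n : ℤ)])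
    (hi₁ : i₁ ≡ ((k : ℤ) + (k' : ℤ)) / 2 [ZMOD (m.gcd n : ℤ)]) :
    ∃ γ : Set.Icc (0 : ℝ) 1 ≃ₜ closure (YIrrComp m n k k'),
      (∀ t, (γ t : CharVariety (TorusGroup m n)) ∈ YIrrComp m n k k' ↔
        0 < (t : ℝ) ∧ (t : ℝ) < 1) ∧
      IsDiagChar (γ 0).1 (eigVal m k) (eigVal n k') ∧
      IsDiagChar (γ 1).1 (eigVal m k) (eigVal n k')⁻¹ ∧
      (γ 0).1 ∈ YRedComp m n i₀ ∧
      (γ 1).1 ∈ YRedComp m n i₁ ∧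
      closure (YIrrComp m n k k') ∩ YRed (TorusGroup m n) = {(γ 0).1, (γ 1).1} := by
  have hm : m ≠ 0 := (hk.trans hkm).ne'
  have hn : n ≠ 0 := (hk'.trans hkn).ne'
  have hpi := Real.pi_pos
  set c : ℝ → CharVariety (TorusGroup m n) := fun φ => charPointSU2 (arcRep hm hn hkk φ) with hc
  have hcont : Continuous c := continuous_arc hm hn hkk
  have hinj : Set.InjOn c (Set.Icc 0 Real.pi) := injOn_arc hm hn hkk hk hkm hk' hkn
  have hirr : YIrrComp m n k k' = c '' Set.Ioo 0 Real.pi := by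
    ext χ
    rw [mem_YIrrComp_iff hm hn hkk hk hkm hk' hkn]
    exact exists_congr fun φ => and_congr_right fun _ => eq_comm
  have hclosure : closure (YIrrComp m n k k') = c '' Set.Icc 0 Real.pi := by
    rw [hirr]
    -- The image of the compact interval is closed, and the open interval is dense in it.
    apply subset_antisymm
    · exact closure_minimal (Set.image_mono Set.Ioo_subset_Icc_self)
        (isCompact_Icc.image hcont).isClosed
    · rw [← closure_Ioo hpi.ne]
      exact image_closure_subset_closure_image hcont
  have hmem : ∀ t : Set.Icc (0 : ℝ) 1, Real.pi * t ∈ Set.Icc 0 Real.pi := fun t =>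
    ⟨mul_nonneg hpi.le t.2.1, mul_le_of_le_one_right hpi.le t.2.2⟩
  let f : Set.Icc (0 : ℝ) 1 → CharVariety (TorusGroup m n) := fun t => c (Real.pi * t)
  -- A continuous injection of a compact space into a Hausdorff space is an embedding.
  have hf : Topology.IsEmbedding f := by
    refine (Continuous.isClosedEmbedding (by fun_prop) fun s t hst => ?_).isEmbedding
    exact Subtype.ext (mul_left_cancel₀ hpi.ne' (hinj (hmem s) (hmem t) hst))
  have hrange : Set.range f = closure (YIrrComp m n k k') := by
    rw [hclosure]
    ext χ
    constructor
    · rintro ⟨t, rfl⟩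
      exact ⟨_, hmem t, rfl⟩
    · rintro ⟨φ, hφ, rfl⟩
      refine ⟨⟨φ / Real.pi, div_nonneg hφ.1 hpi.le, (div_le_one hpi).2 hφ.2⟩, ?_⟩
      simp only [f, mul_div_cancel₀ _ hpi.ne']
  have hf0 : f 0 = c 0 := by simp [f]
  have hf1 : f 1 = c Real.pi := by simp [f]
  refine ⟨hf.toHomeomorph.trans (Homeomorph.setCongr hrange), ?_⟩
  have hval : ∀ t, ((hf.toHomeomorph.trans (Homeomorph.setCongr hrange) t :
    closure (YIrrComp m n k k')) : CharVariety (TorusGroup m n)) = f t := fun _ => rfl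
  simp only [hval, hf0, hf1]
  have hd0 := isDiagChar_arc_zero hm hn hkk
  have hd1 := isDiagChar_arc_pi hm hn hkk
  refine ⟨fun t => ?_, hd0, hd1, isDiagChar_mem_YRedComp hm hn hi₀ hkk hd0,
    isDiagChar_inv_mem_YRedComp hm hn hi₁ hkk hd1, ?_⟩
  · rw [hirr]
    constructor
    · rintro ⟨φ, hφ, h⟩
      obtain rfl := hinj (Set.Ioo_subset_Icc_self hφ) (hmem t) h
      exact ⟨pos_of_mul_pos_right hφ.1 hpi.le, by nlinarith [hφ.2]⟩
    · rintro ⟨h0, h1⟩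
      exact ⟨_, ⟨mul_pos hpi h0, mul_lt_of_lt_one_right hpi h1⟩, rfl⟩
  · rw [hclosure]
    ext χ
    constructor
    · rintro ⟨⟨φ, hφ, rfl⟩, ρ, hρ, h⟩
      -- The reducible `ρ` need not be `arcRep` at `φ`; the criterion uses only its trace
      -- coordinates.
      have hs := mt (irredSU2_iff_sin_ne_zero hk hkm hk' hkn
        ((charPointSU2_eq_arc_iff hm hn hkk ρ φ).1 h.symm)).2 hρ
      rcases hφ.1.eq_or_lt with rfl | h0
      · exact Or.inl rfl
      rcases hφ.2.eq_or_lt with rfl | h1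
      · exact Or.inr rfl
      exact absurd (Real.sin_pos_of_pos_of_lt_pi h0 h1).ne' hs
    · have hred : ∀ φ, Real.sin φ = 0 → c φ ∈ YRed (TorusGroup m n) := fun φ hφ =>
        ⟨_, fun h => (irredSU2_iff_sin_ne_zero hk hkm hk' hkn
          (traceCoords_arcRep hm hn hkk φ)).1 h hφ, rfl⟩
      rintro (rfl | rfl)
      · exact ⟨⟨_, Set.left_mem_Icc.2 hpi.le, rfl⟩, hred _ Real.sin_zero⟩
      · exact ⟨⟨_, Set.right_mem_Icc.2 hpi.le, rfl⟩, hred _ Real.sin_pi⟩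

end Main
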